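/- Let $\mathbb K$ be a field and $\mathbb L/\mathbb K$ a cyclic Galois extension of finite even degree $n=2t\ge 2$ whose Galois group is generated by $\sigma$, and let $\mathbb L'$ be the intermediate field with $[\mathbb L:\mathbb L']=2$. Let $R=\mathbb L[x;\sigma]$ be the skew polynomial ring, in which $xa=\sigma(a)x$ for $a\in\mathbb L$, and let $Z(R)$ be its centre. Let $f\in R$ be monic and irreducible with $f\notin Z(R)$ and with nonzero constant coefficient $f_0$. Let $F(y)\in\mathbb K[y]$ be the monic polynomial such that $F(x^n)$ is the bound of $f$, i.e. $RF(x^n)=F(x^n)R$ is the largest two-sided ideal contained in $Rf$. Let $s=\deg F$, let $m$ be the number of factors in a factorisation of $F(x^n)$ into irreducible elements of $R$, put $\ell=n/m$, and assume $\deg f=s\ell$. Let $\gamma\in\mathbb L$ be such that $\gamma/f_0\in\mathbb L\setminus\mathbb L'$ and $\mathrm N_{\mathbb L/\mathbb K}(\gamma)$ is not a square in $\mathbb K$. Then every element of $R/Rf$ is the class of a unique $a=(a_0'+\gamma a_0'')+\sum_{i=1}^{s\ell-1}a_ix^i$ with $a_i\in\mathbb L$ and uniquely determined $a_0',a_0''\in\mathbb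 L'$, and the operation on $R/Rf$ given by $$a\star_D b=\Bigl(a-\frac{\gamma}{f_0}\,a_0''\,f\Bigr)b \bmod Rf$$ is well defined and makes $R/Rf$ a unital (not necessarily associative) division algebra over $\mathbb K$ with unity $1$, of dimension $ns\ell$ over $\mathbb K$. (That is, $\star_D$ is $\mathbb K$-bilinear, $1$ is a two-sided identity, and left and right multiplication by every nonzero element are bijective.) Moreover, this construction generalises the dual Hughes--Kleinfeld semifields in the following sense. If $f=x-1$, then $\sigma$ restricts to an automorphism $\tau$ of $\mathbb L'$, one has $\gamma\sigma(\gamma)=u+\gamma w$ for some $u,w\in\mathbb L'$, and $(c_0,c_1)\mapsto c_0+\gamma c_1$ is a $\mathbb K$-linear isomorphism from $\mathbb L'\oplus\mathbb L'$ onto $R/Rf$ which carries the opposite of the Hughes--Kleinfeld multiplication $$(d_0,d_1)\circ(c_0,c_1)=\bigl(d_0c_0+u\,\tau(d_1)c_1,\ d_1c_0+\tau(d_0)c_1+w\,\tau(d_1)c_1\bigr)$$ to $\star_D$; that is, $(d_0,d_1)\circ(c_0,c_1)$ is mapped to $(c_0+\gamma c_1)\star_D(d_0+\gamma d_1)$.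 -/

import Mathlib

noncomputable section

namespace SkewDivision

universe u v

/-- The action of `Multiplicative ℕ` on `L` in which the generator acts as `σ`. It is the datum
from which Mathlib's `SkewPolynomial` builds its multiplication. -/
@[reducible] def skewAction {K : Type u} {L : Type v} [Field K] [Field L] [Algebra K L]
    (σ : L ≃ₐ[K] L) : MulSemiringAction (Multiplicative ℕ) L :=
  MulSemiringAction.compHom L (powersHom (L ≃ₐ[K] L) σ)

/-- The skew polynomial ring `L[x;σ]`, with `x * a = σ a * x` for `a` in `L`. -/
def SkewPoly {K : Type u} {L : Type v} [Field K] [Field L] [Algebra K L]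
    (_σ : L ≃ₐ[K] L) : Type v :=
  SkewPolynomial L

section Ring

variable {K : Type u} {L : Type v} [Field K] [Field L] [Algebra K L] (σ : L ≃ₐ[K] L)

instance instRing : Ring (SkewPoly σ) :=
  letI := skewAction σ
  inferInstanceAs (Ring (SkewPolynomial L))

/-- The constants `L → L[x;σ]`. -/
def const : L →+* SkewPoly σ :=
  letI := skewAction σ
  SkewPolynomial.CRingHom (R := L)

theorem const_algebraMap_commutes (k : K) (p : SkewPoly σ) :
    const σ (algebraMap K L k) * p = p * const σ (algebraMap K L k) := by
  have key : ∀ [MulSemiringAction (Multiplicative ℕ) L] [SMulCommClass (Multiplicative ℕ) K L]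
      (q : SkewPolynomial L),
      SkewPolynomial.C (algebraMap K L k) * q = q * SkewPolynomial.C (algebraMap K L k) :=
    fun q => Algebra.commutes (A := SkewPolynomial L) k q
  exact @key (skewAction σ)
    (letI := skewAction σ; ⟨fun g k a => map_smul (powersHom (L ≃ₐ[K] L) σ g) k a⟩) p

instance instAlgebra : Algebra K (SkewPoly σ) :=
  ((const σ).comp (algebraMap K L)).toAlgebra' fun k p => const_algebraMap_commutes σ k p

/-- The indeterminate `x` of `L[x;σ]`. -/
def indet : SkewPoly σ := SkewPolynomial.X (R := L)

variable {σ}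

/-- The coefficient of `x ^ i` (coefficients are written on the left). -/
def coeff (p : SkewPoly σ) (i : ℕ) : L := SkewPolynomial.coeff (R := L) p i

/-- The degree (with value `0` at the zero polynomial). -/
def deg (p : SkewPoly σ) : ℕ := (SkewPolynomial.support (R := L) p).sup id

/-- Leading coefficient one. -/
def IsMonic (p : SkewPoly σ) : Prop := coeff p (deg p) = 1

theorem indet_mul_const (a : L) : indet σ * const σ a = const σ (σ a) * indet σ := by
  have key : ∀ [MulSemiringAction (Multiplicative ℕ) L],
      (SkewPolynomial.X * SkewPolynomial.C a : SkewPolynomial L) =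
        SkewPolynomial.C (Multiplicative.ofAdd 1 • a) * SkewPolynomial.X := by
    intro _
    rw [← SkewPolynomial.monomial_zero_left, SkewPolynomial.X_mul_monomial,
      SkewPolynomial.C_mul_X_eq_monomial]
    rfl
  have h := @key (skewAction σ)
  have e : (powersHom (L ≃ₐ[K] L) σ (Multiplicative.ofAdd 1)) a = σ a := by simp
  rw [← e]
  exact h

/-- `g` is a bound of `f`: the element `g` is two-sided, that is `Rg = gR`, and this is the largest
two-sided ideal contained in the left ideal `Rf`. -/
structure IsBound (f g : SkewPoly σ) : Prop where
  two_sided : {p : SkewPoly σ | ∃ h, p = h * g} = {p : SkewPoly σ | ∃ h, p = g * h}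
  le : Ideal.span {g} ≤ Ideal.span {f}
  largest : ∀ I : Ideal (SkewPoly σ), I.IsTwoSided → I ≤ Ideal.span {f} → I ≤ Ideal.span {g}

/-- `g` is a product of `m` irreducible elements of `L[x;σ]`. -/
def IsProductOfIrreducibles (g : SkewPoly σ) (m : ℕ) : Prop :=
  ∃ l : List (SkewPoly σ), l.length = m ∧ (∀ p ∈ l, Irreducible p) ∧ l.prod = g

/-- The left `L[x;σ]`-module (and `K`-vector space) `R/Rf`, where `R = L[x;σ]`. -/
abbrev QuotientBy (f : SkewPoly σ) : Type v := SkewPoly σ ⧸ (Ideal.span {f} : Ideal (SkewPoly σ))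

/-- The class of `a` in `R/Rf`. -/
abbrev cls (f a : SkewPoly σ) : QuotientBy f := Submodule.Quotient.mk a

/-- `a = (a' + γ a'') + ∑ i ∈ {1, …, deg f - 1}, a_i x ^ i` with `a'`, `a''` in `L'`. -/
def HasForm (L' : IntermediateField K L) (γ : L) (f a : SkewPoly σ) (a' a'' : L') : Prop :=
  (∀ i, deg f ≤ i → coeff a i = 0) ∧ coeff a 0 = (a' : L) + γ * (a'' : L)

/-- The skew polynomial `a - (γ / f₀) a'' f`. -/
def twist (L' : IntermediateField K L) (γ : L) (f a : SkewPoly σ) (a'' : L') : SkewPoly σ :=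
  a - const σ (γ / coeff f 0 * (a'' : L)) * f

/-- The map `R/Rf → R` sending the class of `a = (a' + γ a'') + ∑ i, a_i x ^ i`, of degree less than
that of `f`, to `a - (γ / f₀) a'' f`. -/
def phi (L' : IntermediateField K L) (γ : L) (f : SkewPoly σ) (α : QuotientBy f) : SkewPoly σ :=
  Classical.epsilon fun p =>
    ∃ (a : SkewPoly σ) (a' a'' : L'),
      HasForm L' γ f a a' a'' ∧ cls f a = α ∧ p = twist L' γ f a a''

/-- The multiplication `⋆_D` on `R/Rf`: the product of `a - (γ / f₀) a'' f` and `b`, modulo `Rf`. -/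
def starD (L' : IntermediateField K L) (γ : L) (f : SkewPoly σ) (α β : QuotientBy f) :
    QuotientBy f :=
  phi L' γ f α • β

end Ring

/-- `mul` makes the `K`-vector space `A` into a (not necessarily associative) division algebra over
`K` with identity element `e`: it is `K`-bilinear, `e` is a two-sided identity, and left and right
multiplication by every nonzero element are invertible. -/
structure IsUnitalDivisionAlgebra (K : Type u) {A : Type v} [Field K] [AddCommGroup A] [Module K A]
    (mul : A → A → A) (e : A) : Prop where
  add_mul : ∀ a b c, mul (a + b) c = mul a c + mul b c
  mul_add : ∀ a b c, mul a (b + c) = mul a b + mul a c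
  smul_mul : ∀ (k : K) (a b : A), mul (k • a) b = k • mul a b
  mul_smul : ∀ (k : K) (a b : A), mul a (k • b) = k • mul a b
  one_mul : ∀ a, mul e a = a
  mul_one : ∀ a, mul a e = a
  one_ne_zero : e ≠ 0
  left_bijective : ∀ a, a ≠ 0 → Function.Bijective fun b => mul a b
  right_bijective : ∀ a, a ≠ 0 → Function.Bijective fun b => mul b a

/-- The Hughes–Kleinfeld multiplication on `E × E` with parameters `τ`, `u`, `w`. -/
def hughesKleinfeldMul {E : Type v} [Field E] (τ : E ≃+* E) (u w : E) (p q : E × E) : E × E :=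
  (p.1 * q.1 + u * τ p.2 * q.2, p.2 * q.1 + τ p.1 * q.2 + w * τ p.2 * q.2)

end SkewDivision

end

noncomputable section

namespace SkewDivision

universe u v

/-! ### Coefficients, degrees and left ideals of the skew polynomial ring. -/

section Coefficients

variable {K : Type u} {L : Type v} [Field K] [Field L] [Algebra K L] {σ : L ≃ₐ[K] L}

/-! Everything rests on the absence of zero divisors: for `α`, `β` nonzero in `R/Rf`, the twisted
representative `phi α = a - c f`, with `c = (γ / f₀) a''`, does not kill `β`. Bilinearity and the
unit are formal, and in finite dimension injective multiplications are bijective.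

Suppose `phi α • β = 0` with `β ≠ 0`. As `f` is irreducible, `R/Rf` is a simple module, so the
annihilator of `β` is `Rg` with `g` monic and `R/Rg ≅ R/Rf` (`exists_generator_of_smul_eq_zero`).
Such an isomorphism forces `deg g = deg f` and `N(g₀) = N(f₀)` (`deg_eq_and_norm_eq_of_equiv`): left
multiplication by `x` is `σ`-semilinear with the companion matrix of `f` in the power basis, so its
`n`-th iterate is `L`-linear with determinant `N(± f₀)`, and the sign disappears because `n` is
even.

Now `a - c f` has degree at most `deg f = deg g` and lies in `Rg`, so it is a constant times `g`;
leading terms give `a - c f = -c g`. The twist is designed so that its constant term is just `a'`,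
whence `a' f₀ = -γ a'' g₀`. If `a'' = 0` then `c = 0` and `a = 0`. Otherwise norms give `N(γ) =
N(a') / N(a'')`, a square since elements of `L'` have square norm (`isSquare_norm_of_mem`), a
contradiction.

For `f = x - 1`, `R/Rf` is `L` with `x` acting as `σ`, and the twist of `c₀ + γ c₁` is `c₀ + γ c₁
x`. The product with `d` is therefore `c₀ d + γ c₁ σ(d)`; expanding in the basis `1`, `γ` gives
Hughes–Kleinfeld with the factors exchanged. -/

@[ext] theorem SkewPoly.ext {p q : SkewPoly σ} (h : ∀ i, coeff p i = coeff q i) : p = q :=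
  SkewPolynomial.ext h

@[simp] theorem coeff_add (p q : SkewPoly σ) (i : ℕ) : coeff (p + q) i = coeff p i + coeff q i :=
  SkewPolynomial.coeff_add (R := L) p q i

@[simp] theorem coeff_zero (i : ℕ) : coeff (0 : SkewPoly σ) i = 0 := rfl

/-- The coefficient of `x ^ i` as an additive map. -/
def coeffHom (i : ℕ) : SkewPoly σ →+ L where
  toFun p := coeff p i
  map_zero' := coeff_zero i
  map_add' p q := coeff_add p q i

@[simp] theorem coeff_sub (p q : SkewPoly σ) (i : ℕ) : coeff (p - q) i = coeff p i - coeff q i :=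
  map_sub (coeffHom i) p q

theorem coeff_sum {ι : Type*} (s : Finset ι) (g : ι → SkewPoly σ) (i : ℕ) :
    coeff (∑ j ∈ s, g j) i = ∑ j ∈ s, coeff (g j) i :=
  map_sum (coeffHom i) g s

theorem const_mul_indet_pow (a : L) (i : ℕ) :
    const σ a * indet σ ^ i = SkewPolynomial.monomial (R := L) i a :=
  letI := skewAction σ
  SkewPolynomial.C_mul_X_pow_eq_monomial (R := L) (a := a) (n := i)

theorem coeff_const_mul_indet_pow (a : L) (i j : ℕ) :
    coeff (const σ a * indet σ ^ i) j = if i = j then a else 0 := by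
  rw [const_mul_indet_pow]
  exact SkewPolynomial.coeff_monomial (R := L)

theorem coeff_const (a : L) (j : ℕ) : coeff (const σ a) j = if 0 = j then a else 0 := by
  simpa using coeff_const_mul_indet_pow (σ := σ) a 0 j

theorem coeff_indet_pow (i j : ℕ) : coeff (indet σ ^ i) j = if i = j then 1 else 0 := by
  simpa using coeff_const_mul_indet_pow (σ := σ) 1 i j

theorem coeff_indet (j : ℕ) : coeff (indet σ) j = if 1 = j then 1 else 0 := by
  simpa using coeff_indet_pow (σ := σ) 1 j

theorem coeff_one (j : ℕ) : coeff (1 : SkewPoly σ) j = if 0 = j then 1 else 0 := by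
  simpa using coeff_indet_pow (σ := σ) 0 j

theorem eq_sum_of_coeff_eq_zero {p : SkewPoly σ} {N : ℕ} (h : ∀ i, N ≤ i → coeff p i = 0) :
    p = ∑ i ∈ Finset.range N, const σ (coeff p i) * indet σ ^ i := by
  ext j
  simp only [coeff_sum, coeff_const_mul_indet_pow, Finset.sum_ite_eq', Finset.mem_range]
  split_ifs with hj
  · rfl
  · exact h j (not_lt.mp hj)

theorem coeff_eq_zero_of_deg_lt {p : SkewPoly σ} {i : ℕ} (h : deg p < i) : coeff p i = 0 := by
  by_contra hne
  have : i ∈ SkewPolynomial.support (R := L) p := SkewPolynomial.mem_support_iff.mpr hne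
  exact absurd (Finset.le_sup (f := id) this) (not_le.mpr h)

theorem coeff_deg_ne_zero {p : SkewPoly σ} (h : p ≠ 0) : coeff p (deg p) ≠ 0 := by
  have hne : (SkewPolynomial.support (R := L) p).Nonempty :=
    Finset.nonempty_iff_ne_empty.mpr fun he => h (SkewPolynomial.support_eq_empty.mp he)
  obtain ⟨i, hi, he⟩ := Finset.exists_mem_eq_sup _ hne id
  have : deg p = i := he
  rw [this]
  exact SkewPolynomial.mem_support_iff.mp hi

theorem indet_pow_mul_const (k : ℕ) (a : L) :
    indet σ ^ k * const σ a = const σ ((σ ^ k) a) * indet σ ^ k := by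
  induction k with
  | zero => simp
  | succ k ih =>
    rw [pow_succ', mul_assoc, ih, ← mul_assoc, indet_mul_const, mul_assoc, ← pow_succ', pow_succ' σ]
    rfl

theorem coeff_monomial_mul (a : L) (k : ℕ) (q : SkewPoly σ) (m : ℕ) :
    coeff (const σ a * indet σ ^ k * q) m =
      if k ≤ m then a * (σ ^ k) (coeff q (m - k)) else 0 := by
  conv_lhs => rw [eq_sum_of_coeff_eq_zero (p := q) (N := deg q + 1)
    fun i hi => coeff_eq_zero_of_deg_lt hi]
  have key : ∀ i, const σ a * indet σ ^ k * (const σ (coeff q i) * indet σ ^ i) =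
      const σ (a * (σ ^ k) (coeff q i)) * indet σ ^ (k + i) := fun i => by
    rw [mul_assoc, ← mul_assoc (indet σ ^ k), indet_pow_mul_const, mul_assoc, ← pow_add,
      ← mul_assoc, ← map_mul]
  simp only [Finset.mul_sum, key, coeff_sum, coeff_const_mul_indet_pow]
  split_ifs with h
  · obtain ⟨j, rfl⟩ := Nat.exists_eq_add_of_le h
    simp only [add_right_inj, Finset.sum_ite_eq', Finset.mem_range, add_tsub_cancel_left]
    split_ifs with hj
    · rfl
    · rw [coeff_eq_zero_of_deg_lt (p := q) (by omega)]; simp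
  · exact Finset.sum_eq_zero fun i _ => if_neg (by omega)

theorem coeff_const_mul (a : L) (q : SkewPoly σ) (m : ℕ) :
    coeff (const σ a * q) m = a * coeff q m := by
  simpa using coeff_monomial_mul a 0 q m

theorem coeff_mul_add {p q : SkewPoly σ} {i j : ℕ} (hp : ∀ k, i < k → coeff p k = 0)
    (hq : ∀ k, j < k → coeff q k = 0) :
    coeff (p * q) (i + j) = coeff p i * (σ ^ i) (coeff q j) := by
  conv_lhs => rw [eq_sum_of_coeff_eq_zero (p := p) (N := i + 1) hp]
  simp only [Finset.sum_mul, coeff_sum, coeff_monomial_mul]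
  rw [Finset.sum_eq_single i]
  · simp
  · intro k hk hne
    rw [Finset.mem_range] at hk
    rw [hq (i + j - k) (by omega)]
    simp
  · simp

theorem coeff_mul_deg_add_deg (p q : SkewPoly σ) :
    coeff (p * q) (deg p + deg q) = coeff p (deg p) * (σ ^ deg p) (coeff q (deg q)) :=
  coeff_mul_add (fun _ => coeff_eq_zero_of_deg_lt) fun _ => coeff_eq_zero_of_deg_lt

/-- Leading coefficients multiply up to a power of `σ`, so a nonzero left multiple of `f` has degree
at least `deg f`. This gives uniqueness of remainders. -/
theorem eq_zero_of_coeff_mul_eq_zero {h f : SkewPoly σ} (hf : f ≠ 0)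
    (H : ∀ i, deg f ≤ i → coeff (h * f) i = 0) : h = 0 := by
  by_contra hne
  have := H (deg h + deg f) (Nat.le_add_left _ _)
  rw [coeff_mul_deg_add_deg] at this
  rcases mul_eq_zero.mp this with h1 | h1
  · exact coeff_deg_ne_zero hne h1
  · exact coeff_deg_ne_zero hf ((map_eq_zero _).mp h1)

theorem eq_const_of_coeff_mul_eq_zero {h f : SkewPoly σ} (hf : f ≠ 0)
    (H : ∀ i, deg f < i → coeff (h * f) i = 0) : h = const σ (coeff h 0) := by
  by_cases hne : h = 0
  · subst hne; simp
  have hd : deg h = 0 := by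
    by_contra hpos
    have := H (deg h + deg f) (by omega)
    rw [coeff_mul_deg_add_deg] at this
    rcases mul_eq_zero.mp this with h1 | h1
    · exact coeff_deg_ne_zero hne h1
    · exact coeff_deg_ne_zero hf ((map_eq_zero _).mp h1)
  ext i
  rw [coeff_const]
  split_ifs with hi
  · rw [hi]
  · exact coeff_eq_zero_of_deg_lt (by omega)

theorem IsMonic.ne_zero {f : SkewPoly σ} (h : IsMonic f) : f ≠ 0 := by
  rintro rfl
  exact zero_ne_one h

/-- Division with remainder by a monic skew polynomial. -/
theorem exists_eq_mul_add {f : SkewPoly σ} (hf : IsMonic f) (p : SkewPoly σ) :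
    ∃ q r : SkewPoly σ, p = q * f + r ∧ ∀ i, deg f ≤ i → coeff r i = 0 := by
  suffices ∀ (N : ℕ) (p : SkewPoly σ), (∀ i, N + deg f ≤ i → coeff p i = 0) →
      ∃ q r : SkewPoly σ, p = q * f + r ∧ ∀ i, deg f ≤ i → coeff r i = 0 from
    this (deg p + 1) p fun i hi => coeff_eq_zero_of_deg_lt (by omega)
  intro N
  induction N with
  | zero => exact fun p hp => ⟨0, p, by simp, by simpa using hp⟩
  | succ N ih =>
    intro p hp
    -- Since `f` is monic, `c * f` has the same coefficient as `p` at `x ^ (N + deg f)`, so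
    -- subtracting it lowers the degree bound by one.
    set c := const σ (coeff p (N + deg f)) * indet σ ^ N with hc
    obtain ⟨q, r, h, hr⟩ := ih (p - c * f) fun i hi => by
      rw [coeff_sub, hc, coeff_monomial_mul, if_pos (by omega)]
      rcases hi.eq_or_lt with rfl | hlt
      · rw [Nat.add_sub_cancel_left, show coeff f (deg f) = 1 from hf]; simp
      · rw [hp i (by omega), coeff_eq_zero_of_deg_lt (p := f) (by omega)]; simp
    exact ⟨q + c, r, by rw [add_mul, add_right_comm, ← h, sub_add_cancel], hr⟩

/-- Every nonzero left ideal is generated by a monic skew polynomial. -/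
theorem exists_isMonic_span_eq (I : Ideal (SkewPoly σ)) (hI : I ≠ ⊥) :
    ∃ g : SkewPoly σ, IsMonic g ∧ I = Ideal.span {g} := by
  classical
  -- The generator is a monic element of least degree; remainders modulo it can be rescaled to be
  -- monic, so minimality makes them vanish.
  have hex : ∃ d, ∃ p ∈ I, coeff p d = 1 ∧ ∀ i, d < i → coeff p i = 0 := by
    obtain ⟨p, hp, hne⟩ := Submodule.exists_mem_ne_zero_of_ne_bot hI
    refine ⟨deg p, const σ (coeff p (deg p))⁻¹ * p, I.mul_mem_left _ hp, ?_, fun i hi => ?_⟩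
    · rw [coeff_const_mul, inv_mul_cancel₀ (coeff_deg_ne_zero hne)]
    · rw [coeff_const_mul, coeff_eq_zero_of_deg_lt hi, mul_zero]
  obtain ⟨g, hg, h1, h0⟩ := Nat.find_spec hex
  have hgne : g ≠ 0 := by rintro rfl; exact zero_ne_one h1
  have hdeg : deg g = Nat.find hex := by
    apply le_antisymm
    · by_contra hlt
      exact coeff_deg_ne_zero hgne (h0 _ (not_le.mp hlt))
    · by_contra hlt
      rw [coeff_eq_zero_of_deg_lt (not_le.mp hlt)] at h1
      exact zero_ne_one h1
  have hmon : IsMonic g := by rw [IsMonic, hdeg, h1]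
  refine ⟨g, hmon, le_antisymm (fun p hp => ?_) ((Ideal.span_singleton_le_iff_mem _).mpr hg)⟩
  obtain ⟨q, r, rfl, hr⟩ := exists_eq_mul_add hmon p
  have hrI : r ∈ I := (I.add_mem_iff_right (I.mul_mem_left q hg)).mp hp
  suffices r = 0 by
    rw [this, add_zero]
    exact Ideal.mem_span_singleton'.mpr ⟨q, rfl⟩
  by_contra hne
  have hlt : deg r < Nat.find hex := by
    by_contra hle
    exact coeff_deg_ne_zero hne (hr _ (hdeg ▸ not_lt.mp hle))
  refine Nat.find_min hex hlt ⟨const σ (coeff r (deg r))⁻¹ * r, I.mul_mem_left _ hrI, ?_,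
    fun i hi => ?_⟩
  · rw [coeff_const_mul, inv_mul_cancel₀ (coeff_deg_ne_zero hne)]
  · rw [coeff_const_mul, coeff_eq_zero_of_deg_lt hi, mul_zero]

/-- Left ideals are principal, so one containing `Rf` comes from a factorisation `f = h * g`, and
one of the factors is a unit. -/
theorem isCoatom_span_of_irreducible {f : SkewPoly σ} (hf : Irreducible f) :
    IsCoatom (Ideal.span {f} : Ideal (SkewPoly σ)) := by
  refine ⟨fun htop => hf.not_isUnit ?_, fun I hI => ?_⟩
  · obtain ⟨h, hh⟩ := Ideal.mem_span_singleton'.mp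
      (htop ▸ Submodule.mem_top : (1 : SkewPoly σ) ∈ Ideal.span {f})
    have hne : f ≠ 0 := by rintro rfl; exact not_irreducible_zero hf
    -- A left inverse is a right inverse: `(f * h - 1) * f = f * (h * f) - f = 0`, and `f` can be
    -- cancelled.
    have hc : f * h = 1 := by
      have : f * h - 1 = 0 := by
        refine eq_zero_of_coeff_mul_eq_zero hne fun i _ => ?_
        rw [sub_mul, mul_assoc, hh, mul_one, one_mul, sub_self, coeff_zero]
      exact sub_eq_zero.mp this
    exact ⟨⟨f, h, hc, hh⟩, rfl⟩
  · obtain ⟨g, -, rfl⟩ := exists_isMonic_span_eq I fun h => not_lt_bot (h ▸ hI)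
    obtain ⟨h, hh⟩ := Ideal.mem_span_singleton'.mp (hI.le (Ideal.mem_span_singleton_self f))
    rcases hf.isUnit_or_isUnit hh.symm with hu | hu
    · refine absurd (Ideal.span_singleton_le_iff_mem _ |>.mpr ?_) hI.not_ge
      obtain ⟨w, rfl⟩ := hu
      exact Ideal.mem_span_singleton'.mpr ⟨↑w⁻¹, by rw [← hh, Units.inv_mul_cancel_left]⟩
    · obtain ⟨w, rfl⟩ := hu
      exact (Ideal.eq_top_iff_one _).mpr (Ideal.mem_span_singleton'.mpr ⟨↑w⁻¹, w.inv_mul⟩)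

end Coefficients

/-! ### Determinants of iterated semilinear maps. -/

section Semilinear

variable {K : Type u} {L : Type v} [Field K] [Field L] [Algebra K L] {σ : L ≃ₐ[K] L}

theorem orderOf_eq_finrank [FiniteDimensional K L] [IsGalois K L]
    (hσ : ∀ τ : L ≃ₐ[K] L, τ ∈ Subgroup.zpowers σ) : orderOf σ = Module.finrank K L := by
  rw [orderOf_eq_card_of_forall_mem_zpowers hσ, IsGalois.card_aut_eq_finrank]

theorem norm_eq_prod_pow [FiniteDimensional K L] [IsGalois K L]
    (hσ : ∀ τ : L ≃ₐ[K] L, τ ∈ Subgroup.zpowers σ) (a : L) :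
    algebraMap K L (Algebra.norm K a) =
      ∏ k ∈ Finset.range (Module.finrank K L), (σ ^ k) a := by
  classical
  rw [Algebra.norm_eq_prod_automorphisms, ← IsCyclic.image_range_orderOf hσ, Finset.prod_image,
    orderOf_eq_finrank hσ]
  intro i hi j hj h
  exact pow_injOn_Iio_orderOf (by simpa using hi) (by simpa using hj) h

/-- The determinant of the `n`-th iterate of a `σ`-semilinear map is the norm of the determinant of
its matrix, when `σ` generates the Galois group of order `n`. -/
theorem det_eq_norm_of_semilinear [FiniteDimensional K L] [IsGalois K L]
    (hσ : ∀ τ : L ≃ₐ[K] L, τ ∈ Subgroup.zpowers σ) {V ι : Type*} [AddCommGroup V] [Module L V]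
    [Fintype ι] [DecidableEq ι] (b : Module.Basis ι L V) (T : V →+ V)
    (hT : ∀ (c : L) (v : V), T (c • v) = σ c • T v) (A : V →ₗ[L] V)
    (hA : ∀ v, A v = T^[Module.finrank K L] v) :
    LinearMap.det A =
      algebraMap K L (Algebra.norm K (Matrix.of fun i j => b.repr (T (b j)) i).det) := by
  set C : Matrix ι ι L := Matrix.of fun i j => b.repr (T (b j)) i with hC
  have hrepr : ∀ (v : V) (i : ι), b.repr (T v) i = ∑ l, C i l * σ (b.repr v l) := fun v i => by
    conv_lhs => rw [← b.sum_repr v, map_sum]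
    simp only [hT, map_sum, map_smul, Finsupp.coe_finsetSum, Finset.sum_apply, Finsupp.smul_apply,
      smul_eq_mul, hC, Matrix.of_apply]
    exact Finset.sum_congr rfl fun _ _ => mul_comm _ _
  have hdet : ∀ k : ℕ, (Matrix.of fun i j => b.repr (T^[k] (b j)) i).det =
      ∏ l ∈ Finset.range k, (σ ^ l) C.det := by
    intro k
    induction k with
    | zero =>
      have : (Matrix.of fun i j => b.repr (T^[0] (b j)) i) = (1 : Matrix ι ι L) := by
        ext i j
        simp [Matrix.one_apply, Finsupp.single_apply, eq_comm]
      rw [this, Finset.prod_range_zero, Matrix.det_one]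
    | succ k ih =>
      -- By semilinearity, composing with `T` multiplies the matrix by `C` on the left after
      -- applying `σ` to its entries.
      have : (Matrix.of fun i j => b.repr (T^[k + 1] (b j)) i) =
          C * (σ : L →+* L).mapMatrix (Matrix.of fun i j => b.repr (T^[k] (b j)) i) := by
        ext i j
        simp [Matrix.mul_apply, Function.iterate_succ_apply', hrepr]
      rw [this, Matrix.det_mul, ← RingHom.map_det, ih, Finset.prod_range_succ', mul_comm]
      simp [pow_succ', map_prod]
  rw [norm_eq_prod_pow hσ, ← hdet, ← LinearMap.det_toMatrix b]
  congr 1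
  ext i j
  rw [LinearMap.toMatrix_apply, hA, Matrix.of_apply]

/-- Such a matrix has companion shape: the first row vanishes except in the last column, and the
complementary minor is the identity. -/
theorem det_of_shift {d : ℕ} (A : Matrix (Fin (d + 1)) (Fin (d + 1)) L)
    (h : ∀ (i : Fin (d + 1)) (j : Fin d), A i j.castSucc = if i = j.succ then 1 else 0) :
    A.det = (-1) ^ d * A 0 (Fin.last d) := by
  rw [Matrix.det_succ_row_zero, Finset.sum_eq_single (Fin.last d)]
  · have : A.submatrix Fin.succ (Fin.last d).succAbove = 1 := by
      ext i j
      simp [h, Matrix.one_apply]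
    rw [this, Matrix.det_one, mul_one, Fin.val_last]
  · intro j _ hj
    obtain ⟨i, rfl⟩ := Fin.exists_castSucc_eq.mpr hj
    simp [h, (Fin.succ_ne_zero i).symm]
  · simp

end Semilinear

/-! ### The quotient `R/Rf` over `L` and its isomorphism invariants. -/

section Quotient

variable {K : Type u} {L : Type v} [Field K] [Field L] [Algebra K L] {σ : L ≃ₐ[K] L}

/-- The `L`-vector space structure of `R/Rf` given by left multiplication with constants. -/
instance instModuleQuotient (f : SkewPoly σ) : Module L (QuotientBy f) :=
  Module.compHom _ (const σ)

theorem smul_eq_const_smul (f : SkewPoly σ) (a : L) (α : QuotientBy f) : a • α = const σ a • α :=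
  rfl

instance instIsScalarTowerQuotient (f : SkewPoly σ) : IsScalarTower K L (QuotientBy f) where
  smul_assoc k a α := by
    obtain ⟨p, rfl⟩ := Submodule.Quotient.mk_surjective _ α
    rw [smul_eq_const_smul, smul_eq_const_smul, ← Submodule.Quotient.mk_smul,
      ← Submodule.Quotient.mk_smul, ← Submodule.Quotient.mk_smul, Algebra.smul_def, map_mul,
      smul_eq_mul, smul_eq_mul, mul_assoc]
    rfl

theorem cls_eq_cls_iff {f a b : SkewPoly σ} : cls f a = cls f b ↔ ∃ h, h * f = a - b := by
  rw [Submodule.Quotient.eq, Ideal.mem_span_singleton']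

theorem exists_cls_eq {f : SkewPoly σ} (hf : IsMonic f) (α : QuotientBy f) :
    ∃ a, (∀ i, deg f ≤ i → coeff a i = 0) ∧ cls f a = α := by
  obtain ⟨p, rfl⟩ := Submodule.Quotient.mk_surjective _ α
  obtain ⟨q, r, h, hr⟩ := exists_eq_mul_add hf p
  exact ⟨r, hr, cls_eq_cls_iff.mpr ⟨-q, by rw [h]; simp⟩⟩

theorem eq_of_cls_eq {f a b : SkewPoly σ} (hf : f ≠ 0) (ha : ∀ i, deg f ≤ i → coeff a i = 0)
    (hb : ∀ i, deg f ≤ i → coeff b i = 0) (h : cls f a = cls f b) : a = b := by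
  obtain ⟨c, hc⟩ := cls_eq_cls_iff.mp h
  have : c = 0 := eq_zero_of_coeff_mul_eq_zero hf fun i hi => by
    rw [hc, coeff_sub, ha i hi, hb i hi, sub_zero]
  rw [this, zero_mul] at hc
  exact sub_eq_zero.mp hc.symm

/-- The linear map sending a tuple to the class of the skew polynomial with these coefficients. -/
def ofCoeffs (f : SkewPoly σ) : (Fin (deg f) → L) →ₗ[L] QuotientBy f :=
  Fintype.linearCombination L fun i : Fin (deg f) => cls f (indet σ ^ (i : ℕ))

theorem ofCoeffs_apply (f : SkewPoly σ) (c : Fin (deg f) → L) :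
    ofCoeffs f c = cls f (∑ i, const σ (c i) * indet σ ^ (i : ℕ)) := by
  rw [ofCoeffs, Fintype.linearCombination_apply]
  exact (map_sum (Submodule.mkQ (Ideal.span {f})) _ _).symm

theorem coeff_sum_fin {d : ℕ} (c : Fin d → L) (j : ℕ) :
    coeff (∑ i, const σ (c i) * indet σ ^ (i : ℕ)) j = if h : j < d then c ⟨j, h⟩ else 0 := by
  simp only [coeff_sum, coeff_const_mul_indet_pow]
  split_ifs with h
  · rw [Finset.sum_eq_single ⟨j, h⟩]
    · simp
    · exact fun i _ hi => if_neg fun hij => hi (Fin.ext hij)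
    · simp
  · exact Finset.sum_eq_zero fun i _ => if_neg (by omega)

theorem ofCoeffs_bijective {f : SkewPoly σ} (hf : IsMonic f) : Function.Bijective (ofCoeffs f) := by
  constructor
  · intro c c' h
    rw [ofCoeffs_apply, ofCoeffs_apply] at h
    have := eq_of_cls_eq hf.ne_zero (fun i hi => by rw [coeff_sum_fin, dif_neg (not_lt.mpr hi)])
      (fun i hi => by rw [coeff_sum_fin, dif_neg (not_lt.mpr hi)]) h
    funext i
    have hi := congrArg (coeff · (i : ℕ)) this
    simpa [coeff_sum_fin] using hi
  · intro α
    obtain ⟨a, ha, rfl⟩ := exists_cls_eq hf α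
    refine ⟨fun i => coeff a i, ?_⟩
    rw [ofCoeffs_apply]
    congr 1
    ext j
    rw [coeff_sum_fin]
    split_ifs with h
    · rfl
    · exact (ha j (not_lt.mp h)).symm

/-- The basis `1, x, …, x ^ (deg f - 1)` of `R/Rf` over `L`. -/
def powerBasis {f : SkewPoly σ} (hf : IsMonic f) : Module.Basis (Fin (deg f)) L (QuotientBy f) :=
  .ofEquivFun (LinearEquiv.ofBijective (ofCoeffs f) (ofCoeffs_bijective hf)).symm

theorem powerBasis_apply {f : SkewPoly σ} (hf : IsMonic f) (i : Fin (deg f)) :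
    powerBasis hf i = cls f (indet σ ^ (i : ℕ)) := by
  classical
  simp [powerBasis, ofCoeffs]

theorem powerBasis_repr_cls {f : SkewPoly σ} (hf : IsMonic f) {a : SkewPoly σ}
    (ha : ∀ i, deg f ≤ i → coeff a i = 0) (i : Fin (deg f)) :
    (powerBasis hf).repr (cls f a) i = coeff a i := by
  have : cls f a = ofCoeffs f fun i => coeff a i := by
    rw [ofCoeffs_apply]
    congr 1
    ext j
    rw [coeff_sum_fin]
    split_ifs with h
    · rfl
    · exact ha j (not_lt.mp h)
  rw [this]
  change ((powerBasis hf).equivFun _) i = _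
  rw [powerBasis, Module.Basis.equivFun_ofEquivFun]
  exact congrFun ((LinearEquiv.ofBijective (ofCoeffs f) (ofCoeffs_bijective hf)).symm_apply_apply
    fun i => coeff a i) i

theorem finrank_quotient {f : SkewPoly σ} (hf : IsMonic f) :
    Module.finrank L (QuotientBy f) = deg f := by
  rw [Module.finrank_eq_card_basis (powerBasis hf), Fintype.card_fin]

/-- Left multiplication by `x ^ n` on `R/Rf`, as an `L`-linear map, where `n` is the order
of `σ`. -/
def indetPowMap {n : ℕ} (hn : σ ^ n = 1) (f : SkewPoly σ) : QuotientBy f →ₗ[L] QuotientBy f where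
  toFun α := indet σ ^ n • α
  map_add' := smul_add _
  map_smul' a α := by
    rw [smul_eq_const_smul, RingHom.id_apply, smul_eq_const_smul, smul_smul, smul_smul,
      indet_pow_mul_const, hn, AlgEquiv.one_apply]

/-- Left multiplication by `x` shifts the power basis and sends its last vector to the class of `x ^
deg f - f`, so the matrix is the companion matrix of `f`. -/
theorem det_matrix_indet {f : SkewPoly σ} (hf : IsMonic f) :
    (Matrix.of fun i j => (powerBasis hf).repr (indet σ • powerBasis hf j) i).det =
      (-1) ^ deg f * coeff f 0 := by
  have hsmul : ∀ j, indet σ • powerBasis hf j = cls f (indet σ ^ ((j : ℕ) + 1)) := fun j => by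
    rw [powerBasis_apply, ← Submodule.Quotient.mk_smul, smul_eq_mul, pow_succ']
  have hlow : ∀ i j : Fin (deg f), (j : ℕ) + 1 < deg f →
      (powerBasis hf).repr (indet σ • powerBasis hf j) i =
        if (i : ℕ) = (j : ℕ) + 1 then 1 else 0 := fun i j hj => by
    rw [hsmul, powerBasis_repr_cls hf fun k hk => by rw [coeff_indet_pow, if_neg (by omega)],
      coeff_indet_pow]
    simp only [eq_comm]
  have hlast : ∀ i j : Fin (deg f), (j : ℕ) + 1 = deg f →
      (powerBasis hf).repr (indet σ • powerBasis hf j) i = -coeff f i := fun i j hj => by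
    have h : cls f (indet σ ^ ((j : ℕ) + 1)) = cls f (indet σ ^ deg f - f) := by
      rw [hj]
      exact cls_eq_cls_iff.mpr ⟨1, by simp⟩
    rw [hsmul, h, powerBasis_repr_cls hf fun k hk => ?_, coeff_sub, coeff_indet_pow,
      if_neg i.2.ne', zero_sub]
    rw [coeff_sub, coeff_indet_pow]
    split_ifs with hk'
    · rw [← hk', show coeff f (deg f) = 1 from hf, sub_self]
    · rw [coeff_eq_zero_of_deg_lt (lt_of_le_of_ne hk hk'), sub_zero]
  -- The basis and the coefficients are abstracted so that `deg f`, which indexes the matrix, can be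
  -- replaced by `0` or `d + 1`. In degree `0` the empty determinant agrees because monicity gives
  -- `f₀ = 1`.
  generalize hB : powerBasis hf = B at hlow hlast ⊢
  clear hsmul hB
  have h1 : coeff f (deg f) = 1 := hf
  generalize hc : (fun i => coeff f i) = c at *
  have hc0 : coeff f 0 = c 0 := by rw [← hc]
  have hcs : ∀ i, coeff f i = c i := fun i => by rw [← hc]
  simp only [hcs] at *
  generalize deg f = d at *
  cases d with
  | zero => simp [h1]
  | succ d =>
    rw [det_of_shift]
    · rw [Matrix.of_apply, hlast _ _ (by simp)]
      simp [pow_succ]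
    · intro i j
      rw [Matrix.of_apply, hlow _ _ (by simp)]
      simp [Fin.ext_iff]

theorem det_indetPowMap [FiniteDimensional K L] [IsGalois K L]
    (hσ : ∀ τ : L ≃ₐ[K] L, τ ∈ Subgroup.zpowers σ) (hn : σ ^ Module.finrank K L = 1)
    {f : SkewPoly σ} (hf : IsMonic f) :
    LinearMap.det (indetPowMap hn f) =
      algebraMap K L (Algebra.norm K ((-1) ^ deg f * coeff f 0)) := by
  rw [← det_matrix_indet hf]
  refine det_eq_norm_of_semilinear hσ (powerBasis hf)
    (DistribSMul.toAddMonoidHom (QuotientBy f) (indet σ)) (fun a α => ?_) _ fun α => ?_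
  · change indet σ • a • α = σ a • indet σ • α
    rw [smul_eq_const_smul, smul_eq_const_smul, smul_smul, smul_smul, indet_mul_const]
  · exact (smul_iterate_apply (indet σ) (Module.finrank K L) α).symm

/-- Monic skew polynomials with isomorphic quotient modules have the same degree, and their constant
coefficients have the same norm if the degree of the extension is even. -/
theorem deg_eq_and_norm_eq_of_equiv [FiniteDimensional K L] [IsGalois K L]
    (hσ : ∀ τ : L ≃ₐ[K] L, τ ∈ Subgroup.zpowers σ) (heven : Even (Module.finrank K L))
    {f g : SkewPoly σ} (hf : IsMonic f) (hg : IsMonic g)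
    (e : QuotientBy f ≃ₗ[SkewPoly σ] QuotientBy g) :
    deg f = deg g ∧ Algebra.norm K (coeff f 0) = Algebra.norm K (coeff g 0) := by
  let e' : QuotientBy f ≃ₗ[L] QuotientBy g :=
    { e with map_smul' := fun a α => e.map_smul (const σ a) α }
  have hpow : σ ^ Module.finrank K L = 1 := by rw [← orderOf_eq_finrank hσ, pow_orderOf_eq_one]
  have hnorm : ∀ (k : ℕ) (a : L), Algebra.norm K ((-1) ^ k * a) = Algebra.norm K a := fun k a => by
    have h1 : Algebra.norm K (-1 : L) = 1 := by
      have := Algebra.norm_algebraMap (S := L) (-1 : K)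
      rwa [map_neg, map_one, heven.neg_one_pow] at this
    rw [map_mul, map_pow, h1, one_pow, one_mul]
  refine ⟨?_, ?_⟩
  · rw [← finrank_quotient hf, ← finrank_quotient hg, e'.finrank_eq]
  · have h := LinearMap.det_conj (indetPowMap hpow f) e'
    -- An `R`-linear isomorphism commutes with `x ^ n`, so the two `L`-linear maps are conjugate and
    -- have equal determinants.
    have hconj : (e' : QuotientBy f →ₗ[L] QuotientBy g) ∘ₗ indetPowMap hpow f ∘ₗ
        (e'.symm : QuotientBy g →ₗ[L] QuotientBy f) = indetPowMap hpow g := by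
      refine LinearMap.ext fun α => ?_
      have h := map_smul e (indet σ ^ Module.finrank K L) (e.symm α)
      rw [e.apply_symm_apply] at h
      exact h
    rw [hconj, det_indetPowMap hσ hpow hg, det_indetPowMap hσ hpow hf, hnorm, hnorm] at h
    exact (algebraMap K L).injective h.symm

end Quotient

/-! ### The twisting map and its linearity. -/

section Twist

variable {K : Type u} {L : Type v} [Field K] [Field L] [Algebra K L] {σ : L ≃ₐ[K] L}

/-- By transitivity, `N_{L/K}(a) = N_{L'/K}(N_{L/L'}(a)) = N_{L'/K}(a) ^ 2` for `a` in `L'`. -/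
theorem isSquare_norm_of_mem [FiniteDimensional K L] {L' : IntermediateField K L}
    (hL' : Module.finrank L' L = 2) (a : L') : IsSquare (Algebra.norm K (a : L)) := by
  rw [← Algebra.norm_norm (S := L') (a := (a : L)),
    show (a : L) = algebraMap L' L a from rfl, Algebra.norm_algebraMap, hL', map_pow]
  exact Even.isSquare_pow even_two _

theorem existsUnique_add_mul {L' : IntermediateField K L} (hL' : Module.finrank L' L = 2) {γ : L}
    (hγ : γ ∉ L') (a : L) : ∃! q : L' × L', a = (q.1 : L) + γ * (q.2 : L) := by
  let T : (L' × L') →ₗ[L'] L :=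
    { toFun := fun q => (q.1 : L) + γ * (q.2 : L)
      map_add' := fun q r => by simp; ring
      map_smul' := fun c q => by simp [Algebra.smul_def]; ring }
  have hinj : Function.Injective T := by
    rw [injective_iff_map_eq_zero]
    rintro ⟨c, d⟩ h
    have h : (c : L) + γ * (d : L) = 0 := h
    by_cases hd : d = 0
    · subst hd
      have : (c : L) = 0 := by simpa using h
      rw [Prod.mk_eq_zero]
      exact ⟨by simpa using this, rfl⟩
    · have hd' : (d : L) ≠ 0 := by simpa using hd
      refine absurd ?_ hγ
      have : γ = ((-c / d : L') : L) := by
        push_cast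
        rw [eq_div_iff hd']
        linear_combination h
      rw [this]
      exact SetLike.coe_mem _
  have : FiniteDimensional L' L := .of_finrank_pos (by omega)
  have hsurj : Function.Surjective T :=
    (LinearMap.injective_iff_surjective_of_finrank_eq_finrank (by simp [hL'])).mp hinj
  obtain ⟨q, hq⟩ := hsurj a
  exact ⟨q, hq.symm, fun r hr => hinj (hr.symm.trans hq.symm)⟩

variable {L' : IntermediateField K L} {γ : L} {f : SkewPoly σ}

theorem existsUnique_hasForm (hf : IsMonic f) (hL' : Module.finrank L' L = 2) (hγ : γ ∉ L')
    (α : QuotientBy f) : ∃! q : SkewPoly σ × L' × L',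
      HasForm L' γ f q.1 q.2.1 q.2.2 ∧ cls f q.1 = α := by
  obtain ⟨a, ha, rfl⟩ := exists_cls_eq hf α
  obtain ⟨q, hq, huniq⟩ := existsUnique_add_mul hL' hγ (coeff a 0)
  refine ⟨(a, q), ⟨⟨ha, hq⟩, rfl⟩, ?_⟩
  rintro ⟨b, r⟩ ⟨⟨hb, hr⟩, h⟩
  obtain rfl : b = a := eq_of_cls_eq hf.ne_zero hb ha h
  rw [huniq r hr]

/-- The choice made in `phi` is harmless: the representative of degree below `deg f` and its
splitting along `1`, `γ` are unique. -/
theorem phi_cls (hf : IsMonic f) (hL' : Module.finrank L' L = 2) (hγ : γ ∉ L') {a : SkewPoly σ}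
    {a' a'' : L'} (h : HasForm L' γ f a a' a'') : phi L' γ f (cls f a) = twist L' γ f a a'' := by
  obtain ⟨b, b', b'', hb, hcls, heq⟩ := Classical.epsilon_spec
    (p := fun p => ∃ (b : SkewPoly σ) (b' b'' : L'),
      HasForm L' γ f b b' b'' ∧ cls f b = cls f a ∧ p = twist L' γ f b b'')
    ⟨_, a, a', a'', h, rfl, rfl⟩
  have := (existsUnique_hasForm hf hL' hγ (cls f a)).unique
    (y₁ := (b, b', b'')) (y₂ := (a, a', a'')) ⟨hb, hcls⟩ ⟨h, rfl⟩
  simp only [Prod.mk.injEq] at this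
  obtain ⟨rfl, rfl, rfl⟩ := this
  exact heq

theorem exists_hasForm (hf : IsMonic f) (hL' : Module.finrank L' L = 2) (hγ : γ ∉ L')
    (α : QuotientBy f) : ∃ (a : SkewPoly σ) (a' a'' : L'), HasForm L' γ f a a' a'' ∧ cls f a = α :=
  let ⟨q, h, _⟩ := existsUnique_hasForm hf hL' hγ α
  ⟨q.1, q.2.1, q.2.2, h⟩

theorem phi_add (hf : IsMonic f) (hL' : Module.finrank L' L = 2) (hγ : γ ∉ L')
    (α β : QuotientBy f) : phi L' γ f (α + β) = phi L' γ f α + phi L' γ f β := by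
  obtain ⟨a, a', a'', ha, rfl⟩ := exists_hasForm hf hL' hγ α
  obtain ⟨b, b', b'', hb, rfl⟩ := exists_hasForm hf hL' hγ β
  have hab : HasForm L' γ f (a + b) (a' + b') (a'' + b'') :=
    ⟨fun i hi => by rw [coeff_add, ha.1 i hi, hb.1 i hi, add_zero], by
      rw [coeff_add, ha.2, hb.2]; push_cast; ring⟩
  rw [← Submodule.Quotient.mk_add, phi_cls hf hL' hγ hab, phi_cls hf hL' hγ ha,
    phi_cls hf hL' hγ hb]
  simp only [twist, IntermediateField.coe_add, mul_add, map_add, add_mul]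
  abel

theorem coeff_smul (k : K) (a : SkewPoly σ) (i : ℕ) : coeff (k • a) i = k • coeff a i := by
  rw [Algebra.smul_def, Algebra.smul_def]
  exact coeff_const_mul _ _ _

theorem phi_smul (hf : IsMonic f) (hL' : Module.finrank L' L = 2) (hγ : γ ∉ L')
    (k : K) (α : QuotientBy f) : phi L' γ f (k • α) = k • phi L' γ f α := by
  obtain ⟨a, a', a'', ha, rfl⟩ := exists_hasForm hf hL' hγ α
  have hka : HasForm L' γ f (k • a) (k • a') (k • a'') :=
    ⟨fun i hi => by rw [coeff_smul, ha.1 i hi, smul_zero], by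
      rw [coeff_smul, ha.2]; simp only [IntermediateField.coe_smul, smul_add, mul_smul_comm]⟩
  have hconst : ∀ c : L, const σ (k • c) = k • const σ c := fun c => by
    rw [Algebra.smul_def, Algebra.smul_def, map_mul]
    rfl
  rw [← Submodule.Quotient.mk_smul, phi_cls hf hL' hγ hka, phi_cls hf hL' hγ ha]
  simp only [twist, IntermediateField.coe_smul, mul_smul_comm, hconst, smul_mul_assoc, smul_sub]

theorem cls_phi (hf : IsMonic f) (hL' : Module.finrank L' L = 2) (hγ : γ ∉ L')
    (α : QuotientBy f) : cls f (phi L' γ f α) = α := by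
  obtain ⟨a, a', a'', ha, rfl⟩ := exists_hasForm hf hL' hγ α
  rw [phi_cls hf hL' hγ ha]
  exact cls_eq_cls_iff.mpr ⟨-const σ (γ / coeff f 0 * (a'' : L)), by simp [twist]⟩

theorem deg_pos_of_irreducible (hf : IsMonic f) (hirr : Irreducible f) : 0 < deg f := by
  by_contra h
  have h0 : deg f = 0 := by omega
  have : f = 1 := by
    ext i
    rw [coeff_one]
    split_ifs with hi
    · rw [← hi, ← h0]; exact hf
    · exact coeff_eq_zero_of_deg_lt (by omega)
  exact hirr.not_isUnit (this ▸ isUnit_one)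

theorem phi_one (hf : IsMonic f) (hpos : 0 < deg f) (hL' : Module.finrank L' L = 2)
    (hγ : γ ∉ L') : phi L' γ f (cls f 1) = 1 := by
  have h : HasForm L' γ f 1 1 0 :=
    ⟨fun i hi => by rw [coeff_one, if_neg (by omega)], by simp [coeff_one]⟩
  rw [phi_cls hf hL' hγ h]
  simp [twist]

/-! ### Absence of zero divisors and the division algebra. -/

/-- The annihilator of a nonzero element of `R/Rf`, for `f` irreducible, is generated by a monic
skew polynomial whose quotient module is isomorphic to `R/Rf`. -/
theorem exists_generator_of_smul_eq_zero (hirr : Irreducible f) {β : QuotientBy f} (hβ : β ≠ 0)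
    {p : SkewPoly σ} (hp : p ≠ 0) (hpβ : p • β = 0) :
    ∃ g : SkewPoly σ, IsMonic g ∧ p ∈ Ideal.span {g} ∧
      Nonempty (QuotientBy g ≃ₗ[SkewPoly σ] QuotientBy f) := by
  let T : SkewPoly σ →ₗ[SkewPoly σ] QuotientBy f := LinearMap.toSpanSingleton _ _ β
  have hker : p ∈ LinearMap.ker T := LinearMap.mem_ker.mpr hpβ
  obtain ⟨g, hg, hgker⟩ := exists_isMonic_span_eq (LinearMap.ker T) fun h =>
    hp ((Submodule.mem_bot _).mp (h ▸ hker))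
  have hsurj : Function.Surjective T := by
    have : IsSimpleModule (SkewPoly σ) (QuotientBy f) :=
      isSimpleModule_iff_isCoatom.mpr (isCoatom_span_of_irreducible hirr)
    exact IsSimpleModule.toSpanSingleton_surjective _ hβ
  exact ⟨g, hg, hgker ▸ hker, ⟨(Submodule.quotEquivOfEq _ _ hgker.symm).trans
    (T.quotKerEquivOfSurjective hsurj)⟩⟩

theorem even_finrank (hL' : Module.finrank L' L = 2) : Even (Module.finrank K L) := by
  rw [← Module.finrank_mul_finrank K L' L, hL']
  exact even_two.mul_left _

/-- The operation `⋆_D` has no zero divisors. -/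
theorem eq_zero_of_phi_smul_eq_zero [FiniteDimensional K L] [IsGalois K L]
    (hσ : ∀ τ : L ≃ₐ[K] L, τ ∈ Subgroup.zpowers σ) (hL' : Module.finrank L' L = 2)
    (hf : IsMonic f) (hirr : Irreducible f) (hf₀ : coeff f 0 ≠ 0)
    (hnorm : ¬ IsSquare (Algebra.norm K γ)) {α β : QuotientBy f}
    (h : phi L' γ f α • β = 0) (hβ : β ≠ 0) : α = 0 := by
  have hγ : γ ∉ L' := fun h => hnorm (isSquare_norm_of_mem hL' ⟨γ, h⟩)
  have hpos := deg_pos_of_irreducible hf hirr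
  obtain ⟨a, a', a'', ha, rfl⟩ := exists_hasForm hf hL' hγ α
  by_cases hne : phi L' γ f (cls f a) = 0
  · rw [← cls_phi hf hL' hγ (cls f a), hne]
    exact Submodule.Quotient.mk_zero _
  obtain ⟨g, hg, hmem, ⟨e⟩⟩ := exists_generator_of_smul_eq_zero hirr hβ hne h
  obtain ⟨hdeg, hN⟩ := deg_eq_and_norm_eq_of_equiv hσ (even_finrank hL') hg hf e
  obtain ⟨q, hq⟩ := Ideal.mem_span_singleton'.mp hmem
  rw [phi_cls hf hL' hγ ha, twist] at hq
  set c : L := γ / coeff f 0 * (a'' : L) with hc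
  -- The multiple `q * g = a - c f` has degree at most `deg f = deg g`, which forces `q` to be a
  -- constant.
  have hq0 := eq_const_of_coeff_mul_eq_zero (h := q) hg.ne_zero fun i hi => by
    rw [hq, coeff_sub, coeff_const_mul, ha.1 i (by omega),
      coeff_eq_zero_of_deg_lt (p := f) (by omega), mul_zero, sub_zero]
  generalize coeff q 0 = r at hq0
  subst hq0
  have htop : r = -c := by
    have hgd : coeff g (deg f) = 1 := by rw [← hdeg]; exact hg
    have := congrArg (coeff · (deg f)) hq
    simpa only [coeff_sub, coeff_const_mul, ha.1 _ le_rfl, hgd, show coeff f (deg f) = 1 from hf,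
      mul_one, zero_sub] using this
  -- The constant term of `c f` is `γ a''`, so subtracting it from `a' + γ a''` leaves `a'`.
  have hbot : (a' : L) = -c * coeff g 0 := by
    have := congrArg (coeff · 0) hq
    simp only [coeff_sub, coeff_const_mul, ha.2, htop] at this
    rw [this, hc]
    field_simp
    ring
  by_cases ha'' : (a'' : L) = 0
  · have hc0 : c = 0 := by rw [hc, ha'', mul_zero]
    rw [htop, hc0] at hq
    simp only [neg_zero, map_zero, zero_mul, sub_zero] at hq
    rw [← hq]
    exact Submodule.Quotient.mk_zero _
  · exfalso
    apply hnorm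
    have hNf : Algebra.norm K (coeff f 0) ≠ 0 := Algebra.norm_ne_zero_iff.mpr hf₀
    have hNa : Algebra.norm K (a'' : L) ≠ 0 := Algebra.norm_ne_zero_iff.mpr ha''
    have hprod : Algebra.norm K (a' : L) * Algebra.norm K (coeff f 0) =
        Algebra.norm K γ * Algebra.norm K (a'' : L) * Algebra.norm K (coeff g 0) := by
      have hneg : Algebra.norm K (-1 : L) = 1 := by
        have := Algebra.norm_algebraMap (S := L) (-1 : K)
        rwa [map_neg, map_one, (even_finrank hL').neg_one_pow] at this
      have : (a' : L) * coeff f 0 = -1 * γ * (a'' : L) * coeff g 0 := by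
        rw [hbot, hc]
        field_simp
      rw [← map_mul, this, map_mul, map_mul, map_mul, hneg, one_mul]
    rw [hN] at hprod
    have : Algebra.norm K γ = Algebra.norm K (a' : L) / Algebra.norm K (a'' : L) := by
      rw [eq_div_iff hNa]
      exact (mul_right_cancel₀ hNf hprod).symm
    rw [this]
    exact (isSquare_norm_of_mem hL' a').div (isSquare_norm_of_mem hL' a'')

theorem skewPoly_smul_comm (k : K) (p : SkewPoly σ) (α : QuotientBy f) :
    p • k • α = k • p • α := by
  obtain ⟨a, rfl⟩ := Submodule.Quotient.mk_surjective _ α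
  rw [← Submodule.Quotient.mk_smul, ← Submodule.Quotient.mk_smul, ← Submodule.Quotient.mk_smul,
    ← Submodule.Quotient.mk_smul, smul_eq_mul, smul_eq_mul, mul_smul_comm]

theorem skewPoly_smul_assoc (k : K) (p : SkewPoly σ) (α : QuotientBy f) :
    (k • p) • α = k • p • α := by
  obtain ⟨a, rfl⟩ := Submodule.Quotient.mk_surjective _ α
  rw [← Submodule.Quotient.mk_smul, ← Submodule.Quotient.mk_smul, ← Submodule.Quotient.mk_smul,
    smul_eq_mul, smul_eq_mul, smul_mul_assoc]

theorem finite_quotient [FiniteDimensional K L] (hf : IsMonic f) :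
    Module.Finite K (QuotientBy f) :=
  have := Module.Finite.of_basis (powerBasis hf)
  Module.Finite.trans L _

theorem isUnitalDivisionAlgebra_starD [FiniteDimensional K L] [IsGalois K L]
    (hσ : ∀ τ : L ≃ₐ[K] L, τ ∈ Subgroup.zpowers σ) (hL' : Module.finrank L' L = 2)
    (hf : IsMonic f) (hirr : Irreducible f) (hf₀ : coeff f 0 ≠ 0)
    (hnorm : ¬ IsSquare (Algebra.norm K γ)) :
    IsUnitalDivisionAlgebra K (starD L' γ f) (cls f 1) := by
  have hγ : γ ∉ L' := fun h => hnorm (isSquare_norm_of_mem hL' ⟨γ, h⟩)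
  have hpos := deg_pos_of_irreducible hf hirr
  have := finite_quotient hf
  let M : QuotientBy f →ₗ[K] QuotientBy f →ₗ[K] QuotientBy f :=
    LinearMap.mk₂ K (starD L' γ f)
      (fun a b c => by simp only [starD, phi_add hf hL' hγ, add_smul])
      (fun k a b => by simp only [starD, phi_smul hf hL' hγ, skewPoly_smul_assoc])
      (fun a b c => by simp only [starD, smul_add])
      (fun k a b => by simp only [starD, skewPoly_smul_comm])
  have hM : ∀ {a b}, M a b = 0 → b ≠ 0 → a = 0 :=
    fun h hb => eq_zero_of_phi_smul_eq_zero hσ hL' hf hirr hf₀ hnorm h hb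
  refine
    { add_mul := fun a b c => M.map_add₂ a b c
      mul_add := fun a b c => (M a).map_add b c
      smul_mul := fun k a b => M.map_smul₂ k a b
      mul_smul := fun k a b => (M a).map_smul k b
      one_mul := fun a => by rw [starD, phi_one hf hpos hL' hγ, one_smul]
      mul_one := fun a => ?_
      one_ne_zero := fun h => ?_
      left_bijective := fun a ha => ?_
      right_bijective := fun a ha => ?_ }
  · rw [starD, ← Submodule.Quotient.mk_smul, smul_eq_mul, _root_.mul_one]
    exact cls_phi hf hL' hγ a
  · refine one_ne_zero (α := L) ?_
    have h1 : (1 : SkewPoly σ) = 0 := eq_of_cls_eq hf.ne_zero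
      (fun i hi => by rw [coeff_one, if_neg (by omega)]) (fun i _ => coeff_zero i)
      (h.trans (Submodule.Quotient.mk_zero _).symm)
    simpa [coeff_one] using congrArg (coeff · 0) h1
  · have hinj : Function.Injective (M a) := by
      rw [injective_iff_map_eq_zero]
      intro b hb
      by_contra hne
      exact ha (hM hb hne)
    exact ⟨hinj, LinearMap.injective_iff_surjective.mp hinj⟩
  · have hinj : Function.Injective (M.flip a) := by
      rw [injective_iff_map_eq_zero]
      exact fun b hb => hM hb ha
    exact ⟨hinj, LinearMap.injective_iff_surjective.mp hinj⟩

theorem rank_quotient [FiniteDimensional K L] (hf : IsMonic f) :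
    Module.rank K (QuotientBy f) = ((Module.finrank K L * deg f : ℕ) : Cardinal) := by
  have := finite_quotient hf
  rw [← Module.finrank_eq_rank, ← finrank_quotient hf, Module.finrank_mul_finrank]

/-! ### The case `f = x - 1` and Hughes–Kleinfeld algebras. -/

theorem deg_eq_of_coeff {p : SkewPoly σ} {d : ℕ} (h : coeff p d ≠ 0)
    (h0 : ∀ i, d < i → coeff p i = 0) : deg p = d := by
  apply le_antisymm
  · by_contra hlt
    have hp : p ≠ 0 := by rintro rfl; exact h rfl
    exact coeff_deg_ne_zero hp (h0 _ (not_le.mp hlt))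
  · by_contra hlt
    exact h (coeff_eq_zero_of_deg_lt (not_le.mp hlt))

theorem deg_indet_sub_one : deg (indet σ - 1) = 1 :=
  deg_eq_of_coeff (by simp [coeff_indet, coeff_one]) fun i hi => by
    rw [coeff_sub, coeff_indet, coeff_one, if_neg (by omega), if_neg (by omega), sub_zero]

theorem isMonic_indet_sub_one : IsMonic (indet σ - 1) := by
  rw [IsMonic, deg_indet_sub_one]
  simp [coeff_indet, coeff_one]

theorem hasForm_const (c : L' × L') :
    HasForm L' γ (indet σ - 1) (const σ ((c.1 : L) + γ * (c.2 : L))) c.1 c.2 := by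
  refine ⟨fun i hi => ?_, ?_⟩
  · rw [deg_indet_sub_one] at hi
    rw [coeff_const, if_neg (by omega)]
  · rw [coeff_const, if_pos rfl]

/-- The isomorphism of `L' × L'` with `R/R(x - 1)` given by the basis `1`, `γ` of `L` over `L'`. -/
def prodEquivQuotient (σ : L ≃ₐ[K] L) (hL' : Module.finrank L' L = 2) (hγ : γ ∉ L') :
    (L' × L') ≃ₗ[K] QuotientBy (indet σ - 1) :=
  LinearEquiv.ofBijective
    { toFun := fun p => cls (indet σ - 1) (const σ ((p.1 : L) + γ * (p.2 : L)))
      map_add' := fun p q => by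
        rw [← Submodule.Quotient.mk_add, ← map_add]
        congr 2
        simp only [Prod.fst_add, Prod.snd_add, IntermediateField.coe_add]
        ring
      map_smul' := fun k p => by
        rw [RingHom.id_apply, ← Submodule.Quotient.mk_smul, Algebra.smul_def k (const σ _)]
        change _ = cls _ (const σ (algebraMap K L k) * _)
        rw [← map_mul]
        congr 2
        rw [Prod.smul_fst, Prod.smul_snd, IntermediateField.coe_smul, IntermediateField.coe_smul,
          Algebra.smul_def, Algebra.smul_def]
        ring }
    (by
      constructor
      · intro p q h
        have h' := (existsUnique_hasForm isMonic_indet_sub_one hL' hγ _).unique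
          (y₁ := (const σ ((p.1 : L) + γ * (p.2 : L)), p))
          (y₂ := (const σ ((q.1 : L) + γ * (q.2 : L)), q))
          ⟨hasForm_const p, rfl⟩ ⟨hasForm_const q, h.symm⟩
        exact (Prod.mk.inj h').2
      · intro α
        obtain ⟨a, a', a'', ha, rfl⟩ := exists_hasForm isMonic_indet_sub_one hL' hγ α
        refine ⟨(a', a''), congrArg (cls _) ?_⟩
        ext i
        rw [coeff_const]
        split_ifs with hi
        · rw [← hi, ha.2]
        · exact (ha.1 i (by rw [deg_indet_sub_one]; omega)).symm)

theorem prodEquivQuotient_apply (hL' : Module.finrank L' L = 2) (hγ : γ ∉ L') (p : L' × L') :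
    prodEquivQuotient σ hL' hγ p =
      cls (indet σ - 1) (const σ ((p.1 : L) + γ * (p.2 : L))) := rfl

theorem cls_const_mul_indet (a : L) :
    cls (indet σ - 1) (const σ a * indet σ) = cls (indet σ - 1) (const σ a) :=
  cls_eq_cls_iff.mpr ⟨const σ a, by rw [mul_sub, mul_one]⟩

/-- Here `f₀ = -1`, so the twist of `c₀ + γ c₁` is `c₀ + γ c₁ x`; moving `x` past `d` applies `σ`,
and a final `x` is `1` modulo `R(x - 1)`. -/
theorem starD_const (hL' : Module.finrank L' L = 2) (hγ : γ ∉ L') (c : L' × L') (d : L) :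
    starD L' γ (indet σ - 1) (cls _ (const σ ((c.1 : L) + γ * (c.2 : L)))) (cls _ (const σ d)) =
      cls _ (const σ ((c.1 : L) * d + γ * (c.2 : L) * σ d)) := by
  have h0 : coeff (indet σ - 1) 0 = -1 := by simp [coeff_indet, coeff_one]
  have h : twist L' γ (indet σ - 1) (const σ ((c.1 : L) + γ * (c.2 : L))) c.2 * const σ d =
      const σ ((c.1 : L) * d) + const σ (γ * (c.2 : L) * σ d) * indet σ := by
    have h1 : γ / -1 * (c.2 : L) = -(γ * (c.2 : L)) := by rw [div_neg, div_one, neg_mul]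
    rw [twist, h0, h1, map_neg, map_mul (const σ) _ (σ d), mul_assoc, ← indet_mul_const,
      map_mul (const σ) _ d, map_add]
    noncomm_ring
  rw [starD, phi_cls isMonic_indet_sub_one hL' hγ (hasForm_const c), ← Submodule.Quotient.mk_smul,
    smul_eq_mul, h, Submodule.Quotient.mk_add]
  change _ + cls _ _ = _
  rw [cls_const_mul_indet, ← Submodule.Quotient.mk_add, ← map_add]

/-- For `f = x - 1`, the operation `⋆_D` is opposite to a Hughes–Kleinfeld multiplication. -/
theorem prodEquivQuotient_hughesKleinfeldMul (hL' : Module.finrank L' L = 2) (hγ : γ ∉ L')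
    {τ : L' ≃ₐ[K] L'} (hτ : ∀ y : L', ((τ y : L') : L) = σ (y : L)) {u w : L'}
    (huw : γ * σ γ = (u : L) + γ * (w : L)) (p q : L' × L') :
    prodEquivQuotient σ hL' hγ (hughesKleinfeldMul (τ : L' ≃+* L') u w p q) =
      starD L' γ (indet σ - 1) (prodEquivQuotient σ hL' hγ q) (prodEquivQuotient σ hL' hγ p) := by
  rw [prodEquivQuotient_apply, prodEquivQuotient_apply, prodEquivQuotient_apply, starD_const hL' hγ]
  congr 2
  simp only [hughesKleinfeldMul, AlgEquiv.coe_ringEquiv, IntermediateField.coe_add,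
    IntermediateField.coe_mul, hτ, map_add, map_mul]
  -- The two sides differ only in the term `γ σ(γ) q.2 σ(p.2)`, which `huw` rewrites in the basis
  -- `1`, `γ`.
  linear_combination -(q.2 : L) * σ (p.2 : L) * huw

/-- The Galois group is cyclic, hence abelian, so every intermediate field is normal over `K` and
stable under `σ`. -/
theorem exists_restrict [FiniteDimensional K L] [IsGalois K L]
    (hσ : ∀ τ : L ≃ₐ[K] L, τ ∈ Subgroup.zpowers σ) (L' : IntermediateField K L) :
    ∃ τ : L' ≃ₐ[K] L', ∀ y : L', ((τ y : L') : L) = σ (y : L) := by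
  have : IsCyclic (L ≃ₐ[K] L) := ⟨σ, hσ⟩
  have : IsAbelianGalois K L := .of_isCyclic K L
  exact ⟨σ.restrictNormal L', fun y => σ.restrictNormal_commutes L' y⟩

end Twist

end SkewDivision

end

theorem mainTheorem8 {K : Type*} {L : Type*} [Field K] [Field L] [Algebra K L]
    [FiniteDimensional K L] [IsGalois K L]
    (n : ℕ) (hn : Module.finrank K L = n)
    -- `σ` generates the Galois group
    (σ : L ≃ₐ[K] L) (hσ : ∀ τ : L ≃ₐ[K] L, τ ∈ Subgroup.zpowers σ)
    -- the subfield of index two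
    (L' : IntermediateField K L) (hL' : Module.finrank L' L = 2)
    (f : SkewDivision.SkewPoly σ) (hmonic : SkewDivision.IsMonic f) (hirr : Irreducible f)
    (hcentral : f ∉ Subring.center (SkewDivision.SkewPoly σ))
    -- the bound `F(x ^ n)` of `f`, the number `m` of its irreducible factors, and `ℓ = n / m`
    (F : Polynomial K) (hF : F.Monic)
    (hbound : SkewDivision.IsBound f (Polynomial.aeval (SkewDivision.indet σ ^ n) F))
    (m : ℕ) (hm : SkewDivision.IsProductOfIrreducibles
      (Polynomial.aeval (SkewDivision.indet σ ^ n) F) m)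
    (s ℓ : ℕ) (hs : s = F.natDegree) (hℓ : ℓ = n / m) (hdeg : SkewDivision.deg f = s * ℓ)
    (hf₀ : SkewDivision.coeff f 0 ≠ 0)
    (γ : L) (hγ : γ / SkewDivision.coeff f 0 ∉ L') (hnorm : ¬ IsSquare (Algebra.norm K γ)) :
    -- every element of `R/Rf` is uniquely of the form used to define the operation
    (∀ α : SkewDivision.QuotientBy f, ∃! q : SkewDivision.SkewPoly σ × L' × L',
      SkewDivision.HasForm L' γ f q.1 q.2.1 q.2.2 ∧ SkewDivision.cls f q.1 = α) ∧
    -- the operation is given by the stated formula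
    (∀ (a b : SkewDivision.SkewPoly σ) (a' a'' : L'), SkewDivision.HasForm L' γ f a a' a'' →
      SkewDivision.starD L' γ f (SkewDivision.cls f a) (SkewDivision.cls f b) =
        SkewDivision.cls f
          ((a - SkewDivision.const σ (γ / SkewDivision.coeff f 0 * (a'' : L)) * f) * b)) ∧
    -- it defines a unital division algebra with unity `1`
    SkewDivision.IsUnitalDivisionAlgebra K (SkewDivision.starD L' γ f) (SkewDivision.cls f 1) ∧
    Module.rank K (SkewDivision.QuotientBy f) = ((n * s * ℓ : ℕ) : Cardinal) ∧
    -- for `f = x - 1` it is the opposite (dual) of a Hughes–Kleinfeld algebra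
    (f = SkewDivision.indet σ - 1 →
      ∃ (τ : L' ≃ₐ[K] L') (u w : L'),
        (∀ y : L', ((τ y : L') : L) = σ (y : L)) ∧ γ * σ γ = (u : L) + γ * (w : L) ∧
        ∃ e : (L' × L') ≃ₗ[K] SkewDivision.QuotientBy f,
          (∀ p : L' × L',
            e p = SkewDivision.cls f (SkewDivision.const σ ((p.1 : L) + γ * (p.2 : L)))) ∧
          ∀ p q : L' × L',
            e (SkewDivision.hughesKleinfeldMul (τ : L' ≃+* L') u w p q) =
              SkewDivision.starD L' γ f (e q) (e p)) := by
  -- An element of `L'` would have square norm.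
  have hγ' : γ ∉ L' := fun h => hnorm (SkewDivision.isSquare_norm_of_mem hL' ⟨γ, h⟩)
  refine ⟨SkewDivision.existsUnique_hasForm hmonic hL' hγ', fun a b a' a'' ha => ?_,
    SkewDivision.isUnitalDivisionAlgebra_starD hσ hL' hmonic hirr hf₀ hnorm, ?_, ?_⟩
  · rw [SkewDivision.starD, SkewDivision.phi_cls hmonic hL' hγ' ha]
    rfl
  · rw [SkewDivision.rank_quotient hmonic, hn, hdeg, mul_assoc]
  · rintro rfl
    obtain ⟨τ, hτ⟩ := SkewDivision.exists_restrict hσ L'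
    obtain ⟨⟨u, w⟩, huw, -⟩ := SkewDivision.existsUnique_add_mul hL' hγ' (γ * σ γ)
    exact ⟨τ, u, w, hτ, huw, SkewDivision.prodEquivQuotient σ hL' hγ',
      SkewDivision.prodEquivQuotient_apply hL' hγ',
      SkewDivision.prodEquivQuotient_hughesKleinfeldMul hL' hγ' hτ huw⟩
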